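/- Let $K$ be a field, $S=K[x_1,\dots,x_n]$ and let $I\subseteq S$ be a monomial ideal, i.e. an ideal generated by monomials. Write $\operatorname{ass}(I)=\operatorname{Ass}(S/I)$ for the set of associated primes of $S/I$, and for a monomial $u$ write $\operatorname{supp}(u)$ for the set of variables dividing $u$. A prime filtration of $I$ is a chain $I=I_0\subset I_1\subset\dots\subset I_r=S$ of monomial ideals such that for each $j=1,\dots,r$ there is an isomorphism of $S$-modules $I_j/I_{j-1}\cong S/P_j$ with $P_j$ a prime ideal. It is called pretty clean if, for all $i<j$, $P_i\subseteq P_j$ implies $P_i=P_j$. The monomial ideal $I$ is called pretty clean if it has a pretty clean filtration. A non-unit monomial $u\notin I$ is called a pretty cleaner monomial of $I$ if for all $P\in\operatorname{ass}(I:u)$ and $Q\in\operatorname{ass}(I+Su)$, $P\subseteq Q$ implies $P=Q$. For an integer $k\ge 0$, the class of pretty $k$-clean monomial ideals is defined recursively (as the smallest class with this property): a monomial ideal $I$ is pretty $k$-clean if it is a prime ideal, or if there is a pretty cleaner monomial $u$ of $I$ with $|\operatorname{supp}(u)|\le k+1$ such that both $I:u$ and $I+Su$ are pretty $k$-clean.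 Theorem. Let $I\subseteq S$ be a monomial ideal. (1) If $I$ is pretty $k$-clean for some integer $k\ge 0$, then $I$ is pretty clean. (2) If $I$ is pretty clean and $I\neq S$, then $I$ is pretty $k$-clean for some integer $k\ge 0$. -/

import Mathlib

namespace PrettyClean

variable {K : Type*} [Field K] {n : ℕ}

/-- The monomial `x ^ a = x₁ ^ a₁ ⋯ xₙ ^ aₙ` of `S = K[x₁, …, xₙ]`. -/
noncomputable def mono (K : Type*) [Field K] {n : ℕ} (a : Fin n →₀ ℕ) : MvPolynomial (Fin n) K :=
  MvPolynomial.monomial a 1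

/-- A monomial ideal is an ideal generated by a set of monomials. -/
def IsMonomialIdeal (I : Ideal (MvPolynomial (Fin n) K)) : Prop :=
  ∃ A : Set (Fin n →₀ ℕ), I = Ideal.span (mono K '' A)

/-- `ass(I) = Ass(S / I)`. (Over the Noetherian ring `S`, Mathlib's associated primes, defined
through radicals of annihilators of elements, are the usual ones, see
`isAssociatedPrime_iff`.) -/
def ass (I : Ideal (MvPolynomial (Fin n) K)) : Set (Ideal (MvPolynomial (Fin n) K)) :=
  associatedPrimes (MvPolynomial (Fin n) K) (MvPolynomial (Fin n) K ⧸ I)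

/-- A prime filtration `I = I₀ ⊂ I₁ ⊂ ⋯ ⊂ I_r = S` by monomial ideals. The prime `prime j`, for
`j : Fin r`, is the one belonging to the step from `I_j` to `I_{j+1}`. -/
structure PrimeFiltration (I : Ideal (MvPolynomial (Fin n) K)) where
  /-- the number of steps -/
  r : ℕ
  /-- the ideals `I₀, …, I_r` -/
  ideal : Fin (r + 1) → Ideal (MvPolynomial (Fin n) K)
  /-- the primes of the factors -/
  prime : Fin r → Ideal (MvPolynomial (Fin n) K)
  ideal_zero : ideal 0 = I
  ideal_last : ideal (Fin.last r) = ⊤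
  monomial : ∀ j, IsMonomialIdeal (ideal j)
  lt : ∀ j : Fin r, ideal j.castSucc < ideal j.succ
  isPrime : ∀ j, (prime j).IsPrime
  /-- the factor of consecutive ideals is isomorphic, as an `S`-module, to `S` modulo the prime -/
  factor : ∀ j : Fin r, Nonempty
    ((ideal j.succ ⧸ Submodule.submoduleOf (ideal j.castSucc) (ideal j.succ))
      ≃ₗ[MvPolynomial (Fin n) K] (MvPolynomial (Fin n) K ⧸ prime j))

/-- A prime filtration is pretty clean if `i < j` and `P_i ⊆ P_j` imply `P_i = P_j`. -/
def PrimeFiltration.IsPrettyClean {I : Ideal (MvPolynomial (Fin n) K)}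
    (F : PrimeFiltration I) : Prop :=
  ∀ i j : Fin F.r, i < j → F.prime i ≤ F.prime j → F.prime i = F.prime j

/-- The (monomial) ideal `I` is pretty clean if it has a pretty clean filtration. -/
def IsPrettyClean (I : Ideal (MvPolynomial (Fin n) K)) : Prop :=
  ∃ F : PrimeFiltration I, F.IsPrettyClean

/-- The monomial `x ^ a` is a pretty cleaner monomial of `I`: it is not a unit, is not in `I`, and
`P ∈ ass(I : x ^ a)`, `Q ∈ ass(I + S x ^ a)`, `P ⊆ Q` imply `P = Q`. -/
def IsPrettyCleaner (I : Ideal (MvPolynomial (Fin n) K)) (a : Fin n →₀ ℕ) : Prop :=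
  ¬ IsUnit (mono K a) ∧ mono K a ∉ I ∧
    ∀ P ∈ ass (I.colon {mono K a}), ∀ Q ∈ ass (I ⊔ Ideal.span {mono K a}), P ≤ Q → P = Q

/-- Pretty `k`-clean monomial ideals, defined recursively. The support of `x ^ a`, the set of the
variables that divide it, is `a.support`. -/
inductive IsPrettyKClean (k : ℕ) : Ideal (MvPolynomial (Fin n) K) → Prop
  | of_prime (I : Ideal (MvPolynomial (Fin n) K)) (hI : IsMonomialIdeal I) (hp : I.IsPrime) :
      IsPrettyKClean k I
  | of_cleaner (I : Ideal (MvPolynomial (Fin n) K)) (hI : IsMonomialIdeal I) (a : Fin n →₀ ℕ)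
      (ha : IsPrettyCleaner I a) (hk : a.support.card ≤ k + 1)
      (hcolon : IsPrettyKClean k (I.colon {mono K a}))
      (hadd : IsPrettyKClean k (I ⊔ Ideal.span {mono K a})) :
      IsPrettyKClean k I

end PrettyClean

/-! A factor `J/I ≅ S/P` means `J = I + Sf` and `P = I : f`, and between monomial ideals `f` can be
replaced by a monomial. So a prime filtration is just a chain that adjoins monomials with prime
colons (`HasChain`). (1) Since `S/(I : u) ≅ (I + Su)/I`, chains of `I : u` and `I + Su` concatenate
to one of `I` (`HasChain.append`). The primes of a pretty clean chain are associated
(`HasChain.mem_ass_of_mem`), so the cleaner condition controls pairs across the seam. (2) The first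
monomial `u` of a pretty clean chain is a pretty cleaner: `I : u` is prime, and `ass(I + Su)` lies
among the later primes (`HasChain.mem_of_mem_ass`). Induct along the chain. -/

namespace PrettyClean

open MvPolynomial

variable {K : Type*} [Field K] {n : ℕ}

/-! ### Colon ideals and cyclic factors -/

section Colon

variable {R : Type*} [CommRing R] {I J P : Ideal R}

theorem mem_colon_singleton_mul {x r : R} : r ∈ I.colon {x} ↔ r * x ∈ I := by
  simp

theorem colon_singleton_mul (x y : R) : I.colon {x * y} = (I.colon {x}).colon {y} := by
  ext r
  simp only [mem_colon_singleton_mul]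
  rw [mul_assoc, mul_comm y x]

theorem colon_singleton_of_prime (hP : P.IsPrime) {s : R} (hs : s ∉ P) : P.colon {s} = P := by
  ext r
  rw [mem_colon_singleton_mul]
  exact ⟨fun h => (hP.mem_or_mem h).resolve_right hs, fun h => P.mul_mem_right _ h⟩

theorem colon_singleton_le_of_mem_sup {x y : R} (hy : y ∈ I ⊔ Ideal.span {x}) :
    I.colon {x} ≤ I.colon {y} := by
  intro r hr
  rw [mem_colon_singleton_mul] at hr ⊢
  obtain ⟨i, hi, z, hz, rfl⟩ := Submodule.mem_sup.1 hy
  obtain ⟨c, rfl⟩ := Ideal.mem_span_singleton'.1 hz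
  have : r * (i + c * x) = r * i + c * (r * x) := by ring
  rw [this]
  exact I.add_mem (I.mul_mem_left _ hi) (I.mul_mem_left _ hr)

theorem colon_singleton_eq_of_sup_eq {x y : R}
    (h : I ⊔ Ideal.span {x} = I ⊔ Ideal.span {y}) : I.colon {x} = I.colon {y} :=
  le_antisymm
    (colon_singleton_le_of_mem_sup (h ▸ Ideal.mem_sup_right (Ideal.mem_span_singleton_self y)))
    (colon_singleton_le_of_mem_sup (h ▸ Ideal.mem_sup_right (Ideal.mem_span_singleton_self x)))

/-- Modulo `I`, multiplication by `x` identifies `R / (I : x)` with `(I + R x) / I`. -/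
theorem nonempty_quotient_equiv_colon {x : R} (hJ : J = I ⊔ Ideal.span {x}) :
    Nonempty ((J ⧸ Submodule.submoduleOf I J) ≃ₗ[R] (R ⧸ I.colon {x})) := by
  have hx : x ∈ J := hJ ▸ Ideal.mem_sup_right (Ideal.mem_span_singleton_self x)
  let φ : R →ₗ[R] (J ⧸ Submodule.submoduleOf I J) :=
    (Submodule.submoduleOf I J).mkQ ∘ₗ LinearMap.toSpanSingleton R J ⟨x, hx⟩
  have hker : LinearMap.ker φ = I.colon {x} := by
    ext r
    rw [LinearMap.mem_ker, mem_colon_singleton_mul]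
    change Submodule.Quotient.mk _ = _ ↔ _
    rw [Submodule.Quotient.mk_eq_zero, Submodule.submoduleOf, Submodule.mem_comap]
    rfl
  have hsurj : Function.Surjective φ := by
    intro q
    obtain ⟨⟨y, hy⟩, rfl⟩ := Submodule.Quotient.mk_surjective _ q
    obtain ⟨i, hi, z, hz, h⟩ := Submodule.mem_sup.1 (hJ ▸ hy)
    obtain ⟨c, rfl⟩ := Ideal.mem_span_singleton'.1 hz
    refine ⟨c, ?_⟩
    change Submodule.Quotient.mk _ = _
    rw [Submodule.Quotient.eq, Submodule.submoduleOf, Submodule.mem_comap]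
    change c * x - y ∈ I
    have : c * x - y = -i := by rw [← h]; ring
    rw [this]
    exact I.neg_mem hi
  exact ⟨((Submodule.quotEquivOfEq _ _ hker.symm).trans
    (φ.quotKerEquivOfSurjective hsurj)).symm⟩

/-- The generator is a lift to `J` of the preimage of `1`. -/
theorem exists_generator_of_quotient_equiv (hIJ : I ≤ J)
    (e : (J ⧸ Submodule.submoduleOf I J) ≃ₗ[R] (R ⧸ P)) :
    ∃ x, J = I ⊔ Ideal.span {x} ∧ P = I.colon {x} := by
  obtain ⟨⟨x, hx⟩, hxe⟩ := Submodule.Quotient.mk_surjective _ (e.symm (Submodule.Quotient.mk 1))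
  have key (r : R) : e.symm (Submodule.Quotient.mk r) =
      Submodule.Quotient.mk (r • (⟨x, hx⟩ : J)) := by
    rw [Submodule.Quotient.mk_smul, hxe, ← map_smul, ← Submodule.Quotient.mk_smul, smul_eq_mul,
      mul_one]
  refine ⟨x, le_antisymm (fun y hy => ?_)
    (sup_le hIJ ((Ideal.span_singleton_le_iff_mem J).2 hx)), ?_⟩
  · obtain ⟨r, hr⟩ := Submodule.Quotient.mk_surjective _ (e (Submodule.Quotient.mk ⟨y, hy⟩))
    have h := key r
    rw [hr, e.symm_apply_apply, Submodule.Quotient.eq, Submodule.submoduleOf,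
      Submodule.mem_comap] at h
    change y - r * x ∈ I at h
    exact Submodule.mem_sup.2 ⟨_, h, r * x, Ideal.mul_mem_left _ _
      (Ideal.mem_span_singleton_self x), by ring⟩
  · ext r
    rw [mem_colon_singleton_mul, ← Submodule.Quotient.mk_eq_zero P,
      ← e.symm.map_eq_zero_iff, key, Submodule.Quotient.mk_eq_zero, Submodule.submoduleOf,
      Submodule.mem_comap]
    rfl

end Colon

/-! ### Monomial ideals and monomial generators -/

section Monomial

variable {I J : Ideal (MvPolynomial (Fin n) K)}

theorem mono_add (a b : Fin n →₀ ℕ) : mono K (a + b) = mono K a * mono K b := by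
  simp [mono, monomial_mul]

theorem mono_mem_of_le {a b : Fin n →₀ ℕ} (hab : a ≤ b) (ha : mono K a ∈ I) : mono K b ∈ I := by
  obtain ⟨c, rfl⟩ := exists_add_of_le hab
  rw [mono_add]
  exact I.mul_mem_right _ ha

theorem isMonomialIdeal_iff :
    IsMonomialIdeal I ↔ ∀ f ∈ I, ∀ a ∈ f.support, mono K a ∈ I := by
  constructor
  · rintro ⟨A, rfl⟩ f hf a ha
    obtain ⟨b, hb, hba⟩ := mem_ideal_span_monomial_image.1 hf a ha
    exact mono_mem_of_le hba (Ideal.subset_span ⟨b, hb, rfl⟩)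
  · intro h
    refine ⟨{a | mono K a ∈ I}, le_antisymm (fun f hf => ?_) (Ideal.span_le.2 ?_)⟩
    · exact mem_ideal_span_monomial_image.2 fun a ha => ⟨a, h f hf a ha, le_rfl⟩
    · rintro _ ⟨a, ha, rfl⟩
      exact ha

theorem isMonomialIdeal_top : IsMonomialIdeal (⊤ : Ideal (MvPolynomial (Fin n) K)) :=
  isMonomialIdeal_iff.2 fun _ _ _ _ => Submodule.mem_top

theorem IsMonomialIdeal.sup_span_mono (hI : IsMonomialIdeal I) (a : Fin n →₀ ℕ) :
    IsMonomialIdeal (I ⊔ Ideal.span {mono K a}) := by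
  obtain ⟨A, rfl⟩ := hI
  exact ⟨A ∪ {a}, by rw [Set.image_union, Set.image_singleton, Ideal.span_union]⟩

theorem IsMonomialIdeal.eq_top_or_isUnit (hI : IsMonomialIdeal I) {a : Fin n →₀ ℕ}
    (h : I ⊔ Ideal.span {mono K a} = ⊤) : I = ⊤ ∨ IsUnit (mono K a) := by
  obtain ⟨A, rfl⟩ := hI
  rw [← Set.image_singleton, ← Ideal.span_union, ← Set.image_union, Ideal.eq_top_iff_one] at h
  obtain ⟨b, hb, hb0⟩ := mem_ideal_span_monomial_image.1 h 0 (by simp)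
  obtain rfl := le_antisymm hb0 zero_le
  obtain hb | hb := hb
  · exact .inl ((Ideal.eq_top_iff_one _).2 (Ideal.subset_span ⟨0, hb, rfl⟩))
  · obtain rfl := hb
    exact .inr isUnit_one

theorem IsMonomialIdeal.colon_mono (hI : IsMonomialIdeal I) (a : Fin n →₀ ℕ) :
    IsMonomialIdeal (I.colon {mono K a}) := by
  rw [isMonomialIdeal_iff] at hI ⊢
  intro f hf b hb
  rw [mem_colon_singleton_mul] at hf ⊢
  rw [← mono_add]
  refine hI _ hf _ ?_
  rw [mem_support_iff, mono, coeff_mul_monomial, mul_one]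
  exact mem_support_iff.1 hb

/-- At an exponent that is minimal in `J` modulo `I`, a multiple of an element `f` of `J` has the
coefficient of `f` times a constant. -/
theorem coeff_mul_of_minimal (hJ : IsMonomialIdeal J) {v : Fin n →₀ ℕ}
    (hv : Minimal (fun a => mono K a ∈ J ∧ mono K a ∉ I) v) {f : MvPolynomial (Fin n) K}
    (hf : f ∈ J) (g : MvPolynomial (Fin n) K) :
    coeff v (g * f) = coeff 0 g * coeff v f := by
  classical
  rw [coeff_mul, Finset.sum_eq_single (0, v)]
  · rintro ⟨x, y⟩ hxy hne
    by_contra h0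
    have hy : mono K y ∈ J :=
      isMonomialIdeal_iff.1 hJ f hf y (mem_support_iff.2 (right_ne_zero_of_mul h0))
    have hsum : x + y = v := Finset.HasAntidiagonal.mem_antidiagonal.1 hxy
    have hyv : y ≤ v := hsum ▸ le_add_self
    have hvy : v ≤ y := hv.2 ⟨hy, fun h => hv.1.2 (mono_mem_of_le hyv h)⟩ hyv
    obtain rfl := le_antisymm hyv hvy
    exact hne (by rw [add_eq_right.1 hsum])
  · exact fun h => absurd (Finset.HasAntidiagonal.mem_antidiagonal.2 (zero_add v)) h

/-- Exponents minimal in `J` modulo `I` give independent minimal generators of `J/I`. As `J/I` is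
cyclic, there is only one. -/
theorem exists_mono_generator (hI : IsMonomialIdeal I) (hJ : IsMonomialIdeal J) (hlt : I < J)
    {f : MvPolynomial (Fin n) K} (hf : J = I ⊔ Ideal.span {f}) :
    ∃ a, J = I ⊔ Ideal.span {mono K a} := by
  classical
  have hfJ : f ∈ J := hf ▸ Ideal.mem_sup_right (Ideal.mem_span_singleton_self f)
  -- Write `x ^ v = i + g * f` with `i ∈ I` and compare coefficients at `w`.
  have hcoeff {v : Fin n →₀ ℕ} (hv : Minimal (fun a => mono K a ∈ J ∧ mono K a ∉ I) v) :
      ∃ g : MvPolynomial (Fin n) K, ∀ w, Minimal (fun a => mono K a ∈ J ∧ mono K a ∉ I) w →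
        coeff 0 g * coeff w f = if v = w then 1 else 0 := by
    obtain ⟨i, hi, z, hz, h⟩ := Submodule.mem_sup.1 (hf ▸ hv.1.1)
    obtain ⟨g, rfl⟩ := Ideal.mem_span_singleton'.1 hz
    refine ⟨g, fun w hw => ?_⟩
    have hiw : coeff w i = 0 := by
      by_contra hne
      exact hw.1.2 (isMonomialIdeal_iff.1 hI i hi w (mem_support_iff.2 hne))
    rw [← coeff_mul_of_minimal hJ hw hfJ, ← coeff_monomial, ← mono, ← h, coeff_add, hiw, zero_add]
  obtain ⟨p, hpJ, hpI⟩ := SetLike.exists_of_lt hlt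
  have hD : ∃ a, mono K a ∈ J ∧ mono K a ∉ I := by
    by_contra! hD
    obtain ⟨A, rfl⟩ := hI
    exact hpI (mem_ideal_span_monomial_image.2 fun a ha => mem_ideal_span_monomial_image.1
      (hD a (isMonomialIdeal_iff.1 hJ p hpJ a ha)) a (by simp [mono]))
  obtain ⟨b, hb⟩ := hD
  obtain ⟨v, -, hv⟩ := exists_minimal_le_of_wellFoundedLT
    (fun a => mono K a ∈ J ∧ mono K a ∉ I) b hb
  refine ⟨v, le_antisymm ?_ (sup_le hlt.le ((Ideal.span_singleton_le_iff_mem J).2 hv.1.1))⟩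
  obtain ⟨A, rfl⟩ := id hJ
  refine Ideal.span_le.2 ?_
  rintro _ ⟨c, hc, rfl⟩
  by_cases hcI : mono K c ∈ I
  · exact Ideal.mem_sup_left hcI
  obtain ⟨w, hwc, hw⟩ := exists_minimal_le_of_wellFoundedLT
    (fun a => mono K a ∈ Ideal.span (mono K '' A) ∧ mono K a ∉ I) c
    ⟨Ideal.subset_span ⟨c, hc, rfl⟩, hcI⟩
  have hvw : v = w := by
    by_contra hne
    obtain ⟨g, hg⟩ := hcoeff hv
    obtain ⟨g', hg'⟩ := hcoeff hw
    have h1 := hg v hv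
    have h2 := hg w hw
    have h3 := hg' w hw
    rw [if_pos rfl] at h1 h3
    rw [if_neg hne] at h2
    exact (mul_ne_zero (left_ne_zero_of_mul (h1 ▸ one_ne_zero))
      (right_ne_zero_of_mul (h3 ▸ one_ne_zero))) h2
  subst hvw
  exact mono_mem_of_le hwc (Ideal.mem_sup_right (Ideal.mem_span_singleton_self _))

end Monomial

/-- `HasChain I L`: starting from the monomial ideal `I`, one reaches `S` by successively adjoining
monomials, where `L` is the list of the colon ideals of the steps and these are prime. -/
inductive HasChain : Ideal (MvPolynomial (Fin n) K) → List (Ideal (MvPolynomial (Fin n) K)) → Prop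
  | top : HasChain ⊤ []
  | step (I : Ideal (MvPolynomial (Fin n) K)) (a : Fin n →₀ ℕ)
      (L : List (Ideal (MvPolynomial (Fin n) K))) (hI : IsMonomialIdeal I)
      (hp : (I.colon {mono K a}).IsPrime) (h : HasChain (I ⊔ Ideal.span {mono K a}) L) :
      HasChain I (I.colon {mono K a} :: L)

/-! ### Prime filtrations as chains of monomials -/

section Filtration

variable {I : Ideal (MvPolynomial (Fin n) K)}

theorem HasChain.ofFn {r : ℕ} (ideal : Fin (r + 1) → Ideal (MvPolynomial (Fin n) K))
    (prime : Fin r → Ideal (MvPolynomial (Fin n) K)) (hlast : ideal (Fin.last r) = ⊤)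
    (hmon : ∀ j, IsMonomialIdeal (ideal j)) (hprime : ∀ j, (prime j).IsPrime)
    (hstep : ∀ j : Fin r, ∃ a, ideal j.succ = ideal j.castSucc ⊔ Ideal.span {mono K a} ∧
      prime j = (ideal j.castSucc).colon {mono K a}) :
    HasChain (ideal 0) (List.ofFn prime) := by
  induction r with
  | zero =>
    rw [List.ofFn_zero, show (0 : Fin (0 + 1)) = Fin.last 0 from rfl, hlast]
    exact .top
  | succ r ih =>
    obtain ⟨a, ha, hp⟩ := hstep 0
    have hp0 := hprime 0
    rw [hp] at hp0
    rw [List.ofFn_succ, hp]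
    refine .step _ a _ (hmon _) hp0 ?_
    change HasChain (ideal (Fin.castSucc 0) ⊔ _) _
    rw [← ha]
    exact ih (fun j => ideal j.succ) (fun j => prime j.succ) hlast (fun j => hmon _)
      (fun j => hprime _) (fun j => hstep j.succ)

theorem PrimeFiltration.hasChain (F : PrimeFiltration I) : HasChain I (List.ofFn F.prime) := by
  have h := HasChain.ofFn F.ideal F.prime F.ideal_last F.monomial F.isPrime fun j => by
    obtain ⟨e⟩ := F.factor j
    obtain ⟨x, hx, hP⟩ := exists_generator_of_quotient_equiv (F.lt j).le e
    obtain ⟨a, ha⟩ := exists_mono_generator (F.monomial _) (F.monomial _) (F.lt j) hx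
    exact ⟨a, ha, hP.trans (colon_singleton_eq_of_sup_eq (hx.symm.trans ha))⟩
  rwa [F.ideal_zero] at h

theorem HasChain.exists_primeFiltration {L : List (Ideal (MvPolynomial (Fin n) K))}
    (h : HasChain I L) : ∃ F : PrimeFiltration I, List.ofFn F.prime = L := by
  induction h with
  | top =>
    exact ⟨⟨0, fun _ => ⊤, Fin.elim0, rfl, rfl, fun _ => isMonomialIdeal_top, fun j => j.elim0,
      fun j => j.elim0, fun j => j.elim0⟩, rfl⟩
  | step I a L hI hp _ ih =>
    obtain ⟨F, rfl⟩ := ih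
    refine ⟨⟨F.r + 1, Fin.cons I F.ideal, Fin.cons (I.colon {mono K a}) F.prime, rfl,
      F.ideal_last, Fin.cases hI F.monomial, Fin.cases ?lt F.lt, Fin.cases hp F.isPrime,
      Fin.cases ?factor F.factor⟩, ?ofFn⟩
    case lt =>
      change I < F.ideal 0
      rw [F.ideal_zero, left_lt_sup, Ideal.span_singleton_le_iff_mem]
      intro ha
      exact hp.ne_top (by simpa using ha)
    case factor => exact nonempty_quotient_equiv_colon F.ideal_zero
    case ofFn =>
      rw [List.ofFn_succ]
      rfl

theorem isPrettyClean_iff_hasChain : IsPrettyClean I ↔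
    ∃ L, HasChain I L ∧ L.Pairwise fun P Q => P ≤ Q → P = Q := by
  constructor
  · rintro ⟨F, hF⟩
    exact ⟨_, F.hasChain, List.pairwise_ofFn.2 fun i j hij => hF i j hij⟩
  · rintro ⟨L, hL, hpw⟩
    obtain ⟨F, rfl⟩ := hL.exists_primeFiltration
    exact ⟨F, fun i j hij => List.pairwise_ofFn.1 hpw hij⟩

end Filtration

/-! ### Associated primes and the primes of a chain -/

section Ass

variable {I P : Ideal (MvPolynomial (Fin n) K)} {L : List (Ideal (MvPolynomial (Fin n) K))}

theorem mem_ass_iff : P ∈ ass I ↔ P.IsPrime ∧ ∃ f, P = I.colon {f} := by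
  have key (f : MvPolynomial (Fin n) K) :
      (⊥ : Submodule (MvPolynomial (Fin n) K) (MvPolynomial (Fin n) K ⧸ I)).colon
        {Ideal.Quotient.mk I f} = I.colon {f} := by
    ext r
    rw [Submodule.mem_colon_singleton, mem_colon_singleton_mul, Submodule.mem_bot,
      ← Ideal.Quotient.eq_zero_iff_mem, map_mul]
    rfl
  rw [ass, AssociatedPrimes.mem_iff, isAssociatedPrime_iff,
    Ideal.Quotient.mk_surjective.exists]
  simp only [key]

theorem HasChain.mem_of_mem_ass (h : HasChain I L) (hP : P ∈ ass I) : P ∈ L := by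
  induction h with
  | top =>
    obtain ⟨hp, f, rfl⟩ := mem_ass_iff.1 hP
    exact absurd (by simp) hp.ne_top
  | step I a L hI hp h ih =>
    obtain ⟨hpP, f, hf⟩ := mem_ass_iff.1 hP
    rw [List.mem_cons]
    -- With `u = x ^ a`: if `s` exists, then `s f ≡ t u` modulo `I`, so `P = I : s f = (I : u) : t =
    -- I : u`. Otherwise `P = (I + Su) : f`.
    by_cases hs : ∃ s, s ∉ P ∧ s * f ∈ I ⊔ Ideal.span {mono K a}
    · left
      obtain ⟨s, hsP, hsf⟩ := hs
      obtain ⟨i, hi, z, hz, hsum⟩ := Submodule.mem_sup.1 hsf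
      obtain ⟨t, rfl⟩ := Ideal.mem_span_singleton'.1 hz
      have h1 : I.colon {s * f} = P := by
        rw [mul_comm, colon_singleton_mul, ← hf, colon_singleton_of_prime hpP hsP]
      have h2 : I.colon {s * f} = I.colon {t * mono K a} := by
        ext r
        rw [mem_colon_singleton_mul, mem_colon_singleton_mul, ← hsum, mul_add,
          I.add_mem_iff_right (I.mul_mem_left r hi)]
      rw [h1, mul_comm, colon_singleton_mul] at h2
      by_cases ht : t ∈ I.colon {mono K a}
      · exact absurd (h2.trans (by simpa using ht)) hpP.ne_top
      · exact h2.trans (colon_singleton_of_prime hp ht)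
    · right
      push Not at hs
      refine ih (mem_ass_iff.2 ⟨hpP, f, le_antisymm ?_ ?_⟩)
      · rw [hf]
        exact Submodule.colon_mono le_sup_left subset_rfl
      · intro s hs'
        by_contra hsP
        exact hs s hsP (mem_colon_singleton_mul.1 hs')

/-- Let `P = (I + Su) : w` be a later prime. If `I : u ⊆ P`, pretty cleanness gives equality;
otherwise some `s ∈ I : u` outside `P` kills `u` modulo `I`, and `P = I : w s`. -/
theorem HasChain.mem_ass_of_mem (h : HasChain I L) (hpw : L.Pairwise fun P Q => P ≤ Q → P = Q)
    (hP : P ∈ L) : P ∈ ass I := by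
  induction h with
  | top => simp at hP
  | step I a L hI hp h ih =>
    rw [List.pairwise_cons] at hpw
    rw [mem_ass_iff]
    obtain rfl | hPL := List.mem_cons.1 hP
    · exact ⟨hp, _, rfl⟩
    obtain ⟨hpP, w, hw⟩ := mem_ass_iff.1 (ih hpw.2 hPL)
    refine ⟨hpP, ?_⟩
    by_cases hle : I.colon {mono K a} ≤ P
    · exact ⟨mono K a, (hpw.1 P hPL hle).symm⟩
    obtain ⟨s, hs, hsP⟩ := SetLike.not_le_iff_exists.1 hle
    refine ⟨w * s, le_antisymm (fun t ht => ?_) (fun t ht => ?_)⟩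
    · rw [hw, mem_colon_singleton_mul] at ht
      rw [mem_colon_singleton_mul, ← mul_assoc, mul_comm]
      obtain ⟨i, hi, z, hz, hsum⟩ := Submodule.mem_sup.1 ht
      obtain ⟨c, rfl⟩ := Ideal.mem_span_singleton'.1 hz
      have : s * (i + c * mono K a) = s * i + c * (s * mono K a) := by ring
      rw [← hsum, this]
      exact I.add_mem (I.mul_mem_left _ hi) (I.mul_mem_left _ (mem_colon_singleton_mul.1 hs))
    · have h' := Submodule.colon_mono (le_sup_left : I ≤ I ⊔ Ideal.span {mono K a}) subset_rfl ht
      rwa [colon_singleton_mul, ← hw, colon_singleton_of_prime hpP hsP] at h'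

theorem ass_of_prime (hI : I.IsPrime) (hP : P ∈ ass I) : P = I := by
  obtain ⟨hp, f, rfl⟩ := mem_ass_iff.1 hP
  refine colon_singleton_of_prime hI fun hf => hp.ne_top ?_
  simpa using hf

end Ass

/-- A chain of `I : x ^ a` followed by a chain of `I + S x ^ a` is a chain of `I`. -/
theorem HasChain.append {I J : Ideal (MvPolynomial (Fin n) K)} (hI : IsMonomialIdeal I)
    {a : Fin n →₀ ℕ} (hJ : J = I.colon {mono K a}) {L L' : List (Ideal (MvPolynomial (Fin n) K))}
    (h : HasChain J L) (h' : HasChain (I ⊔ Ideal.span {mono K a}) L') :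
    HasChain I (L ++ L') := by
  induction h generalizing I with
  | top =>
    have ha : mono K a ∈ I := by simpa using hJ.symm
    rwa [sup_eq_left.2 ((Ideal.span_singleton_le_iff_mem I).2 ha)] at h'
  | step J b L _ hp _ ih =>
    have hcol : J.colon {mono K b} = I.colon {mono K (a + b)} := by
      rw [mono_add, colon_singleton_mul, hJ]
    rw [hcol] at hp ⊢
    refine .step I (a + b) _ hI hp (ih (hI.sup_span_mono _) ?_ ?_)
    -- This is `(I : x ^ a) + S x ^ b = (I + S x ^ (a + b)) : x ^ a`.
    · ext r
      rw [mem_colon_singleton_mul, hJ, Submodule.mem_sup, Submodule.mem_sup]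
      constructor
      · rintro ⟨j, hj, z, hz, rfl⟩
        obtain ⟨c, rfl⟩ := Ideal.mem_span_singleton'.1 hz
        exact ⟨j * mono K a, mem_colon_singleton_mul.1 hj, c * mono K (a + b),
          Ideal.mul_mem_left _ _ (Ideal.mem_span_singleton_self _), by rw [mono_add]; ring⟩
      · rintro ⟨i, hi, z, hz, hsum⟩
        obtain ⟨c, rfl⟩ := Ideal.mem_span_singleton'.1 hz
        refine ⟨r - c * mono K b, mem_colon_singleton_mul.2 ?_, c * mono K b,
          Ideal.mul_mem_left _ _ (Ideal.mem_span_singleton_self _), by ring⟩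
        have : (r - c * mono K b) * mono K a = i := by
          rw [sub_mul, ← hsum, mono_add]
          ring
        rwa [this]
    · have hle : Ideal.span {mono K (a + b)} ≤ Ideal.span {mono K a} := by
        rw [Ideal.span_singleton_le_span_singleton, mono_add]
        exact dvd_mul_right _ _
      rwa [sup_assoc, sup_eq_right.2 hle]

/-! ### The two implications -/

theorem IsPrettyKClean.isPrettyClean {k : ℕ} {I : Ideal (MvPolynomial (Fin n) K)}
    (h : IsPrettyKClean k I) : IsPrettyClean I := by
  induction h with
  | of_prime I hI hp =>
    have h1 : mono K (0 : Fin n →₀ ℕ) = 1 := rfl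
    have hcol : I.colon {mono K 0} = I := by
      ext r
      rw [mem_colon_singleton_mul, h1, mul_one]
    refine isPrettyClean_iff_hasChain.2 ⟨_, .step I 0 [] hI (by rwa [hcol]) ?_, by simp⟩
    rw [h1, Ideal.span_singleton_one, sup_top_eq]
    exact .top
  | of_cleaner I hI a ha _ _ _ ih ih' =>
    rw [isPrettyClean_iff_hasChain] at ih ih' ⊢
    obtain ⟨L, hL, hpw⟩ := ih
    obtain ⟨L', hL', hpw'⟩ := ih'
    exact ⟨L ++ L', hL.append hI rfl hL', List.pairwise_append.2 ⟨hpw, hpw', fun P hP Q hQ =>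
      ha.2.2 P (hL.mem_ass_of_mem hpw hP) Q (hL'.mem_ass_of_mem hpw' hQ)⟩⟩

theorem HasChain.isPrettyKClean {I : Ideal (MvPolynomial (Fin n) K)}
    {L : List (Ideal (MvPolynomial (Fin n) K))} (h : HasChain I L)
    (hpw : L.Pairwise fun P Q => P ≤ Q → P = Q) (hne : I ≠ ⊤) : IsPrettyKClean n I := by
  induction h with
  | top => exact absurd rfl hne
  | step I a L hI hp h ih =>
    rw [List.pairwise_cons] at hpw
    -- A unit is no cleaner, but then `I` equals its prime colon ideal.
    by_cases hunit : IsUnit (mono K a)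
    · have hcol : I.colon {mono K a} = I := by
        ext r
        rw [mem_colon_singleton_mul, Ideal.mul_unit_mem_iff_mem I hunit]
      exact .of_prime I hI (hcol ▸ hp)
    have htop : I ⊔ Ideal.span {mono K a} ≠ ⊤ := fun htop =>
      (hI.eq_top_or_isUnit htop).elim hne hunit
    refine .of_cleaner I hI a ⟨hunit, fun ha => hp.ne_top (by simpa using ha), ?_⟩ ?_
      (.of_prime _ (hI.colon_mono a) hp) (ih hpw.2 htop)
    · intro P hP Q hQ
      rw [ass_of_prime hp hP]
      exact hpw.1 Q (h.mem_of_mem_ass hQ)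
    -- A support has at most `n` variables, so `k = n` always suffices.
    · exact (Finset.card_le_univ _).trans (by simp)

end PrettyClean

theorem mainTheorem3 {K : Type*} [Field K] {n : ℕ} (I : Ideal (MvPolynomial (Fin n) K))
    (hI : PrettyClean.IsMonomialIdeal I) :
    (∀ k : ℕ, PrettyClean.IsPrettyKClean k I → PrettyClean.IsPrettyClean I) ∧
      (I ≠ ⊤ → PrettyClean.IsPrettyClean I → ∃ k : ℕ, PrettyClean.IsPrettyKClean k I) := by
  refine ⟨fun k h => h.isPrettyClean, fun hne h => ?_⟩
  obtain ⟨L, hL, hpw⟩ := PrettyClean.isPrettyClean_iff_hasChain.1 h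
  exact ⟨n, hL.isPrettyKClean hpw hne⟩
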